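/- Work in the nonstandard universe given by ultrapowers ${}^{*}X = X^{I}/U$ along an arbitrary ultrafilter $U$ on an arbitrary index set $I$. Let $\eta\in{}^{*}\mathbb{N}$ be infinite (that is, $\eta>n$ for every standard $n\in\mathbb{N}$), and let $(s_i)_{1\le i\le\eta}$ be an internal sequence in ${}^{*}[0,1)$. Let $\mathcal{C}_\eta$ be the internal algebra of subsets of ${}^{*}[0,1)$ consisting of the internal unions of cells $[\frac{j}{\eta},\frac{j+1}{\eta})$, $0\le j\le\eta-1$, and let $\delta_\eta:\mathcal{C}_\eta\to{}^{*}\mathbb{R}$ be the internal counting measure $$\delta_\eta(V)={}^{*}\!\!\sum_{[\frac{j}{\eta},\frac{j+1}{\eta})\subseteq V}\frac{1}{\eta}\,{}^{*}\mathrm{Card}\Big\{1\le i\le\eta : s_i\in\Big[\frac{j}{\eta},\frac{j+1}{\eta}\Big)\Big\}.$$ Let $L(\delta_\eta)$ be the associated Loeb measure, i.e. the Carathéodory extension of the standard part ${}^{\circ}\delta_\eta$ to the ($L(\delta_\eta)$-complete) Loeb $\sigma$-algebra $L(\mathcal{C}_\eta)$ generated by $\mathcal{C}_\eta$. The sequence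 is called weakly equidistributed if, for all $a\le b$ in ${}^{*}[0,1)$, the interval $(a,b)$ belongs to $L(\mathcal{C}_\eta)$ and $L(\delta_\eta)((a,b))={}^{\circ}(b-a)$. For $k\in{}^{*}\mathbb{Z}$ let $\exp_\eta(2\pi i k x)={}^{*}\exp\big(2\pi i k\,\frac{[\eta x]}{\eta}\big)$, $x\in{}^{*}[0,1)$, be the $\mathcal{C}_\eta$-measurable counterpart of ${}^{*}\exp(2\pi i k x)$, where $[\cdot]$ is the integer part. Then $(s_i)_{1\le i\le\eta}$ is weakly equidistributed if and only if $$\frac{1}{\eta}\;{}^{*}\!\!\sum_{1\le j\le\eta}\exp_\eta(2\pi i k s_j)\simeq 0$$ for every finite $k\in{}^{*}\mathbb{Z}$ with $k\ne0$ and $-\eta\le k\le\eta-1$, where $z\simeq0$ means that $|z|<\varepsilon$ for every standard real $\varepsilon>0$. -/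

import Mathlib

open Filter MeasureTheory
open scoped ENNReal

noncomputable section

namespace NSWeyl

universe u v w

/-- The nonstandard extension `*α`: the ultrapower of `α` along the ultrafilter `U`.
Elements of `*(Set α)`, `*(Finset α)` are the internal (hyperfinite) subsets of `*α`, and
elements of `*(α → β)` are the internal functions from `*α` to `*β`. -/
abbrev Star {ι : Type u} (U : Ultrafilter ι) (α : Type v) : Type (max u v) :=
  Germ (U : Filter ι) α

section Basic

variable {ι : Type u} {U : Ultrafilter ι} {α : Type v} {β : Type w}

/-- The value `F x` of an internal function `F` at a point `x`. -/
def Star.app (F : Star U (α → β)) (x : Star U α) : Star U β :=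
  Germ.map₂ (fun f a => f a) F x

/-- Membership `x ∈ J` in a hyperfinite internal set `J`. -/
def Star.Mem (x : Star U α) (J : Star U (Finset α)) : Prop :=
  Germ.LiftRel (fun a A => a ∈ A) x J

/-- The hyperfinite sum `*∑_{x ∈ J} F x` of an internal function. -/
def Star.sum [AddCommMonoid β] (J : Star U (Finset α)) (F : Star U (α → β)) : Star U β :=
  Germ.map₂ (fun A f => ∑ a ∈ A, f a) J F

/-- The inclusion `*ℕ → *ℝ`. -/
def Star.toReal (n : Star U ℕ) : Star U ℝ := Germ.map (fun m : ℕ => (m : ℝ)) n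

/-- The inclusion `*ℕ → *ℤ`. -/
def Star.toInt (n : Star U ℕ) : Star U ℤ := Germ.map (fun m : ℕ => (m : ℤ)) n

/-- The inclusion `*ℕ → *ℂ`. -/
def Star.toComplex (n : Star U ℕ) : Star U ℂ := Germ.map (fun m : ℕ => (m : ℂ)) n

/-- `η ∈ *ℕ` is infinite: it exceeds every standard natural number. -/
def Star.IsInfinite (η : Star U ℕ) : Prop := ∀ n : ℕ, (n : Star U ℕ) < η

/-- `k ∈ *ℤ` is finite: it is bounded in absolute value by a standard natural number. -/
def Star.IsFinite (k : Star U ℤ) : Prop :=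
  ∃ n : ℕ, -(n : Star U ℤ) ≤ k ∧ k ≤ (n : Star U ℤ)

/-- `z ≃ 0` in `*ℂ`: `|z| < ε` for every standard real `ε > 0`. -/
def Star.IsInfinitesimal (z : Star U ℂ) : Prop :=
  ∀ ε : ℝ, 0 < ε → Germ.map (fun c : ℂ => ‖c‖) z < (Germ.const ε : Star U ℝ)

variable (U) in
/-- The nonstandard half-open unit interval `*[0,1)`. -/
abbrev StarUnit : Type u := Set.Ico (0 : Star U ℝ) 1

end Basic

section Loeb

variable {ι : Type u} {U : Ultrafilter ι}

/-- The cell `[j/η, (j+1)/η)` of `*[0,1)`. -/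
def cell (η j : Star U ℕ) : Set (StarUnit U) :=
  {x | j.toReal / η.toReal ≤ (x : Star U ℝ) ∧ (x : Star U ℝ) < (j.toReal + 1) / η.toReal}

/-- `J` is an internal subset of `{0, …, η - 1}`. -/
def IsIndexSet (η : Star U ℕ) (J : Star U (Finset ℕ)) : Prop :=
  J ≤ Germ.map Finset.range η

/-- The internal union of the cells `[j/η, (j+1)/η)` over `j ∈ J`. The internal algebra `C_η` on
`*[0,1)` consists of these sets, for internal `J ⊆ {0, …, η - 1}`. -/
def cellUnion (η : Star U ℕ) (J : Star U (Finset ℕ)) : Set (StarUnit U) :=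
  {x | ∃ j : Star U ℕ, j.Mem J ∧ x ∈ cell η j}

/-- Standard counterpart of the mass of a cell: the proportion of the `i ∈ {1, …, n}` such that
`f i ∈ [j/n, (j+1)/n)`. -/
def stdCellMass (n : ℕ) (f : ℕ → ℝ) (j : ℕ) : ℝ :=
  1 / (n : ℝ) *
    (((Finset.Icc 1 n).filter
      fun i => (j : ℝ) / n ≤ f i ∧ f i < ((j : ℝ) + 1) / n).card : ℝ)

/-- The internal function `j ↦ δ_η([j/η, (j+1)/η)) = (1/η) *Card {1 ≤ i ≤ η : s_i ∈ [j/η, (j+1)/η)}`.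
-/
def cellMass (η : Star U ℕ) (s : Star U (ℕ → ℝ)) : Star U (ℕ → ℝ) :=
  Germ.map₂ stdCellMass η s

/-- The `*ℝ`-valued counting measure `δ_η(V) = *∑_{j ∈ J} δ_η([j/η, (j+1)/η))` of the element
`V = cellUnion η J` of `C_η`. -/
def delta (η : Star U ℕ) (s : Star U (ℕ → ℝ)) (J : Star U (Finset ℕ)) : Star U ℝ :=
  Star.sum J (cellMass η s)

/-- The real-valued premeasure `V ↦ °δ_η(V)` on `C_η`, extended by `∞` to sets outside `C_η`.
As `V ∈ C_η` determines its index set `J`, the infimum is over one value if `V ∈ C_η`, and it is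
over no value at all otherwise. -/
def loebPremeasure (η : Star U ℕ) (s : Star U (ℕ → ℝ)) (V : Set (StarUnit U)) : ℝ≥0∞ :=
  ⨅ (J : Star U (Finset ℕ)) (_ : IsIndexSet η J ∧ V = cellUnion η J),
    ENNReal.ofReal (ArchimedeanClass.stdPart (delta η s J))

theorem loebPremeasure_empty (η : Star U ℕ) (s : Star U (ℕ → ℝ)) :
    loebPremeasure η s ∅ = 0 := by
  have h1 : IsIndexSet η (Germ.const ∅ : Star U (Finset ℕ)) := by
    induction η using Germ.inductionOn with
    | _ f => exact Germ.coe_le.2 (Eventually.of_forall fun _ => Finset.empty_subset _)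
  have h2 : (∅ : Set (StarUnit U)) = cellUnion η (Germ.const ∅) := by
    symm
    rw [Set.eq_empty_iff_forall_notMem]
    rintro x ⟨j, hj, -⟩
    induction j using Germ.inductionOn with
    | _ f =>
      have h3 : ∀ᶠ i in (U : Filter ι), f i ∈ (∅ : Finset ℕ) := hj
      exact h3.exists.elim fun _ h => Finset.notMem_empty _ h
  have h3 : delta η s (Germ.const ∅) = 0 := by
    induction η using Germ.inductionOn with
    | _ f =>
      induction s using Germ.inductionOn with
      | _ g => exact Germ.coe_eq.2 (Eventually.of_forall fun _ => Finset.sum_empty)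
  refine le_antisymm (iInf₂_le_of_le (Germ.const ∅) ⟨h1, h2⟩ ?_) (bot_le)
  rw [h3, ArchimedeanClass.stdPart_zero, ENNReal.ofReal_zero]

/-- The Carathéodory outer measure generated by `°δ_η` on `C_η`. -/
def loebOuter (η : Star U ℕ) (s : Star U (ℕ → ℝ)) : OuterMeasure (StarUnit U) :=
  OuterMeasure.ofFunction (loebPremeasure η s) (loebPremeasure_empty η s)

/-- The Loeb σ-algebra `L(C_η)`: the Carathéodory measurable sets. The premeasure being finite,
this is the completion of the σ-algebra generated by `C_η`. -/
@[reducible] def loebAlgebra (η : Star U ℕ) (s : Star U (ℕ → ℝ)) : MeasurableSpace (StarUnit U) :=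
  (loebOuter η s).caratheodory

/-- The Loeb measure `L(δ_η)`: the Carathéodory extension of `°δ_η` to `L(C_η)`. -/
def loebMeasure (η : Star U ℕ) (s : Star U (ℕ → ℝ)) :
    @Measure (StarUnit U) (loebAlgebra η s) :=
  @OuterMeasure.toMeasure (StarUnit U) (loebAlgebra η s) (loebOuter η s) le_rfl

/-- The sequence `s_1, …, s_η` is weakly equidistributed: every interval `(a,b)`, with endpoints
`a ≤ b` in `*[0,1)`, is Loeb measurable with Loeb measure (the standard part of) `b - a`. -/
def WeaklyEquidistributed (η : Star U ℕ) (s : Star U (ℕ → ℝ)) : Prop :=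
  ∀ a b : StarUnit U, a ≤ b →
    MeasurableSet[loebAlgebra η s] (Set.Ioo a b) ∧
      loebMeasure η s (Set.Ioo a b) =
        ENNReal.ofReal (ArchimedeanClass.stdPart ((b : Star U ℝ) - (a : Star U ℝ)))

end Loeb

section Weyl

variable {ι : Type u} {U : Ultrafilter ι}

/-- The internal function `x ↦ *exp(2πikx)`. -/
def starExp (k : Star U ℤ) : Star U (ℝ → ℂ) :=
  Germ.map (fun (m : ℤ) (x : ℝ) => Complex.exp (2 * Real.pi * Complex.I * m * x)) k

/-- The `C_η`-measurable counterpart `x ↦ F([ηx]/η)` of an internal function `F`, which is constant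
on each cell, with the value of `F` at the left endpoint. -/
def counterpart (η : Star U ℕ) (F : Star U (ℝ → ℂ)) : Star U (ℝ → ℂ) :=
  Germ.map₂ (fun (n : ℕ) (f : ℝ → ℂ) (x : ℝ) => f ((⌊(n : ℝ) * x⌋ : ℝ) / n)) η F

/-- `exp_η(2πikx)`. -/
def expEta (η : Star U ℕ) (k : Star U ℤ) : Star U (ℝ → ℂ) := counterpart η (starExp k)

/-- The Weyl mean `(1/η) *∑_{1 ≤ i ≤ η} exp_η(2πik s_i)`. -/
def weylMean (η : Star U ℕ) (s : Star U (ℕ → ℝ)) (k : Star U ℤ) : Star U ℂ :=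
  1 / η.toComplex *
    Star.sum (Germ.map (Finset.Icc 1) η)
      (Germ.map₂ (fun (f : ℝ → ℂ) (t : ℕ → ℝ) (i : ℕ) => f (t i)) (expEta η k) s)

end Weyl

end NSWeyl

end

noncomputable section

namespace NSWeyl

open scoped Topology

universe u v w

/-! ### Weyl's criterion for weighted finite point sets along a filter -/

section WeightedPoints

variable {ι : Type u} {α : Type v} {l : Filter ι} {S : ι → Finset α} {w : ι → α → ℝ}

/-! Choose representatives `n`, `g` of `η`, `s`. A finite `k` is a standard integer, and being
infinitesimal means tending to `0` along `U`. Since `exp_η` is constant on cells, the Weyl mean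
becomes `cellMean`: the `k`-th exponential moment of the probability measure that puts the mass of
each cell at its left endpoint. The theorem thus compares weak convergence of these measures to
Lebesgue measure along `U` with the Loeb values of intervals.

If the moments vanish, density of trigonometric polynomials and approximation of closed arcs from
above bound the limiting mass of an interval by its length (`eventually_sum_le_length`). An interval
`(a,b)` differs from an internal union of cells by part of two end cells, which are null by this
bound, so it is Loeb measurable. The same bound on the cells covering `(a,b)` gives one inequality.
Applied to the cells on either side, together with total outer mass at least `1`, it gives the
other. The total mass rests on saturation (`exists_subset_biUnion_of_subset_iUnion`), for which the
divergence of `n` along `U` suffices, whatever the ultrafilter.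

Conversely, the Loeb value of an interval bounds from below the mass of any union of cells
containing it. Lower bounds on the pieces of a fine grid, with total mass `1`, force nearly uniform
masses, and exponential sums over a uniform grid vanish (`norm_sum_mul_exp_le`). -/

theorem integral_fourier_of_ne_zero {k : ℤ} (hk : k ≠ 0) :
    ∫ x : UnitAddCircle, fourier k x = 0 := by
  have h := congrFun (fourierCoeff_fourier (T := 1) k) 0
  rw [Pi.single_eq_of_ne hk.symm, fourierCoeff, AddCircle.integral_haarAddCircle] at h
  simpa using h

theorem norm_sum_mul_le {T : Finset α} {v : α → ℝ} {f : α → ℂ} {C : ℝ} (hv : ∀ m ∈ T, 0 ≤ v m)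
    (hf : ∀ m ∈ T, ‖f m‖ ≤ C) : ‖∑ m ∈ T, (v m : ℂ) * f m‖ ≤ C * ∑ m ∈ T, v m := by
  rw [Finset.mul_sum]
  refine norm_sum_le_of_le _ fun m hm => ?_
  rw [norm_mul, Complex.norm_real, Real.norm_of_nonneg (hv m hm), mul_comm]
  exact mul_le_mul_of_nonneg_right (hf m hm) (hv m hm)

/-- Weyl's criterion, from exponentials to continuous functions on the circle. -/
theorem tendsto_sum_mul_continuousMap {x : ι → α → UnitAddCircle}
    (hw : ∀ᶠ i in l, ∀ m ∈ S i, 0 ≤ w i m) (hw1 : ∀ᶠ i in l, ∑ m ∈ S i, w i m = 1)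
    (hx : ∀ k : ℤ, k ≠ 0 →
      Tendsto (fun i => ∑ m ∈ S i, (w i m : ℂ) * fourier k (x i m)) l (𝓝 0))
    (φ : C(UnitAddCircle, ℂ)) :
    Tendsto (fun i => ∑ m ∈ S i, (w i m : ℂ) * φ (x i m)) l (𝓝 (∫ y, φ y)) := by
  have hint : ∀ ψ : C(UnitAddCircle, ℂ), Integrable (fun y => ψ y) := fun ψ =>
    ψ.continuous.integrable_of_hasCompactSupport (HasCompactSupport.of_compactSpace _)
  have huniv : (volume : Measure UnitAddCircle).real Set.univ = 1 := by
    simp [Measure.real]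
  have hspan : ∀ ψ ∈ Submodule.span ℂ (Set.range (@fourier 1)),
      Tendsto (fun i => ∑ m ∈ S i, (w i m : ℂ) * ψ (x i m)) l (𝓝 (∫ y, ψ y)) := by
    intro ψ hψ
    induction hψ using Submodule.span_induction with
    | mem ψ h =>
      obtain ⟨k, rfl⟩ := h
      rcases eq_or_ne k 0 with rfl | hk
      · have h1 : ∫ y : UnitAddCircle, fourier 0 y = (1 : ℂ) := by simp [huniv]
        rw [h1]
        refine tendsto_const_nhds.congr' ?_
        filter_upwards [hw1] with i hi
        simp only [fourier_zero, mul_one]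
        rw [← Complex.ofReal_sum, hi, Complex.ofReal_one]
      · rw [integral_fourier_of_ne_zero hk]
        exact hx k hk
    | zero => simpa using tendsto_const_nhds
    | add ψ χ _ _ h1 h2 =>
      simp only [ContinuousMap.add_apply, mul_add, Finset.sum_add_distrib]
      rw [integral_add (hint ψ) (hint χ)]
      exact h1.add h2
    | smul c ψ _ h =>
      simp only [ContinuousMap.smul_apply, smul_eq_mul, mul_left_comm _ c, ← Finset.mul_sum]
      rw [integral_const_mul]
      exact h.const_mul c
  rw [Metric.tendsto_nhds]
  intro ε hε
  -- Total mass `1` makes replacing `φ` by a trigonometric polynomial cost at most `ε / 4` in the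
  -- sum, uniformly in `i`, and likewise in the integral.
  have hφ : φ ∈ closure (Submodule.span ℂ (Set.range (@fourier 1)) : Set C(UnitAddCircle, ℂ)) := by
    rw [← Submodule.topologicalClosure_coe, span_fourier_closure_eq_top]
    trivial
  obtain ⟨ψ, hψ, hd⟩ := Metric.mem_closure_iff.1 hφ (ε / 4) (by positivity)
  have hle : ∀ y, ‖φ y - ψ y‖ ≤ ε / 4 := fun y => by
    rw [← ContinuousMap.sub_apply]
    exact (ContinuousMap.norm_coe_le_norm _ y).trans (by rw [← dist_eq_norm]; exact hd.le)
  filter_upwards [hw, hw1, Metric.tendsto_nhds.1 (hspan ψ hψ) (ε / 4) (by positivity)]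
    with i h0 h1 h2
  have h3 : dist (∑ m ∈ S i, (w i m : ℂ) * φ (x i m)) (∑ m ∈ S i, (w i m : ℂ) * ψ (x i m))
      ≤ ε / 4 := by
    rw [dist_eq_norm, ← Finset.sum_sub_distrib]
    simp only [← mul_sub]
    simpa [h1] using norm_sum_mul_le (f := fun m => φ (x i m) - ψ (x i m)) h0 fun m _ => hle _
  have h4 : dist (∫ y, ψ y) (∫ y, φ y) ≤ ε / 4 := by
    rw [dist_comm, dist_eq_norm, ← integral_sub (hint φ) (hint ψ)]
    simpa [huniv] using norm_integral_le_of_norm_le_const (μ := (volume : Measure UnitAddCircle))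
      (Eventually.of_forall hle)
  have h5 := dist_triangle4 (∑ m ∈ S i, (w i m : ℂ) * φ (x i m))
    (∑ m ∈ S i, (w i m : ℂ) * ψ (x i m)) (∫ y, ψ y) (∫ y, φ y)
  linarith

theorem exists_continuousMap_integral_le {F : Set UnitAddCircle} (hF : IsClosed F) {ε : ℝ}
    (hε : 0 < ε) : ∃ φ : C(UnitAddCircle, ℝ), (∀ y, 0 ≤ φ y) ∧ (∀ y ∈ F, φ y = 1) ∧
      ∫ y, φ y ≤ volume.real F + ε := by
  have h := HasOuterApproxClosed.tendsto_lintegral_apprSeq hF (volume : Measure UnitAddCircle)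
  have h1 : volume F < volume F + ENNReal.ofReal ε :=
    ENNReal.lt_add_right (measure_ne_top _ _) (by simpa using hε)
  obtain ⟨n, hn⟩ := ((tendsto_order.1 h).2 _ h1).exists
  refine ⟨⟨fun y => hF.apprSeq n y, by fun_prop⟩, fun y => NNReal.coe_nonneg _, fun y hy => ?_, ?_⟩
  · simp [HasOuterApproxClosed.apprSeq_apply_eq_one hF n hy]
  · simp only [ContinuousMap.coe_mk]
    rw [integral_eq_lintegral_of_nonneg_ae (Eventually.of_forall fun _ => NNReal.coe_nonneg _)
      (by fun_prop)]
    simp only [ENNReal.ofReal_coe_nnreal]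
    refine (ENNReal.toReal_mono (by finiteness) hn.le).trans ?_
    rw [ENNReal.toReal_add (by finiteness) (by finiteness), ENNReal.toReal_ofReal hε.le]
    rfl

/-- The portmanteau upper bound: a continuous nonnegative function equal to `1` on `F`, with
integral close to the measure of `F`, dominates the indicator of `F`. -/
theorem eventually_sum_le_of_mem_isClosed {x : ι → α → UnitAddCircle} {T : ι → Finset α}
    {F : Set UnitAddCircle}
    (hw : ∀ᶠ i in l, ∀ m ∈ S i, 0 ≤ w i m) (hw1 : ∀ᶠ i in l, ∑ m ∈ S i, w i m = 1)
    (hx : ∀ k : ℤ, k ≠ 0 →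
      Tendsto (fun i => ∑ m ∈ S i, (w i m : ℂ) * fourier k (x i m)) l (𝓝 0))
    (hF : IsClosed F) (hT : ∀ᶠ i in l, T i ⊆ S i ∧ ∀ m ∈ T i, x i m ∈ F) {ε : ℝ} (hε : 0 < ε) :
    ∀ᶠ i in l, ∑ m ∈ T i, w i m ≤ volume.real F + ε := by
  obtain ⟨φ, h0, h1, h2⟩ := exists_continuousMap_integral_le hF (half_pos hε)
  have h3 := tendsto_sum_mul_continuousMap hw hw1 hx
    ⟨fun y => (φ y : ℂ), by fun_prop⟩
  have h4 := Complex.continuous_re.continuousAt.tendsto.comp h3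
  simp only [ContinuousMap.coe_mk, integral_complex_ofReal, Complex.ofReal_re, Function.comp_def,
    ← Complex.ofReal_mul, ← Complex.ofReal_sum] at h4
  filter_upwards [hw, hT, (tendsto_order.1 h4).2 (volume.real F + ε) (by linarith)]
    with i hi hTi hlt
  refine le_trans ?_ hlt.le
  refine le_trans (Finset.sum_le_sum fun m hm => ?_)
    (Finset.sum_le_sum_of_subset_of_nonneg hTi.1 fun m hm _ => mul_nonneg (hi m hm) (h0 _))
  rw [h1 _ (hTi.2 m hm), mul_one]

/-- If all exponential means tend to `0`, then asymptotically an interval carries at most a mass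
equal to its length. -/
theorem eventually_sum_le_length {y : ι → α → ℝ} {T : ι → Finset α} {a b : ℝ} (hab : a ≤ b)
    (hw : ∀ᶠ i in l, ∀ m ∈ S i, 0 ≤ w i m) (hw1 : ∀ᶠ i in l, ∑ m ∈ S i, w i m = 1)
    (hy : ∀ k : ℤ, k ≠ 0 → Tendsto (fun i => ∑ m ∈ S i,
      (w i m : ℂ) * Complex.exp (2 * Real.pi * Complex.I * k * y i m)) l (𝓝 0))
    (hT : ∀ᶠ i in l, T i ⊆ S i ∧ ∀ m ∈ T i, y i m ∈ Set.Icc a b) {ε : ℝ} (hε : 0 < ε) :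
    ∀ᶠ i in l, ∑ m ∈ T i, w i m ≤ b - a + ε := by
  -- The image of `[a, b]` lies in an arc around the midpoint. Its measure is capped at `1`, so
  -- intervals reaching outside `[0, 1]` are allowed.
  have hvol : volume.real (Metric.closedBall (((a + b) / 2 : ℝ) : UnitAddCircle) ((b - a) / 2))
      ≤ b - a := by
    rw [Measure.real, AddCircle.volume_closedBall]
    refine ENNReal.toReal_le_of_le_ofReal (by linarith) (ENNReal.ofReal_le_ofReal ?_)
    exact (min_le_right _ _).trans (by linarith)
  have hmain := eventually_sum_le_of_mem_isClosed (x := fun i m => (y i m : UnitAddCircle))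
    (T := T) hw hw1 (fun k hk => ?_) (Metric.isClosed_closedBall
      (x := (((a + b) / 2 : ℝ) : UnitAddCircle)) (ε := (b - a) / 2)) ?_ hε
  · filter_upwards [hmain] with i hi
    linarith
  · simpa [fourier_coe_apply] using hy k hk
  · filter_upwards [hT] with i hi
    refine ⟨hi.1, fun m hm => ?_⟩
    obtain ⟨h1, h2⟩ := hi.2 m hm
    rw [Metric.mem_closedBall, dist_eq_norm, ← AddCircle.coe_sub]
    refine (QuotientAddGroup.norm_mk_le_norm).trans ?_
    rw [Real.norm_eq_abs, abs_le]
    constructor <;> linarith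

end WeightedPoints

/-! ### From lower bounds on intervals to exponential sums -/

section Grid

/-- A geometric sum of an `M`-th root of unity, which is not `1` because `M` does not divide `k`. -/
theorem sum_range_exp_div_eq_zero {k : ℤ} {M : ℕ} (hk : k ≠ 0) (hM : |k| < M) :
    ∑ p ∈ Finset.range M, Complex.exp (2 * Real.pi * Complex.I * k * ((p : ℝ) / M : ℝ)) = 0 := by
  have hM0 : (M : ℂ) ≠ 0 := by
    have : (0 : ℤ) < M := (abs_nonneg k).trans_lt hM
    exact_mod_cast this.ne'
  set z : ℂ := Complex.exp (2 * Real.pi * Complex.I * (k / M)) with hz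
  have h1 : ∀ p ∈ Finset.range M,
      Complex.exp (2 * Real.pi * Complex.I * k * ((p : ℝ) / M : ℝ)) = z ^ p := fun p _ => by
    rw [hz, ← Complex.exp_nat_mul]
    congr 1
    push_cast
    ring
  have hzM : z ^ M = 1 := by
    rw [hz, ← Complex.exp_nat_mul, Complex.exp_eq_one_iff]
    exact ⟨k, by field_simp⟩
  have hz1 : z ≠ 1 := by
    intro h
    rw [hz, Complex.exp_eq_one_iff] at h
    obtain ⟨c, hc⟩ := h
    have h2 : (k : ℂ) = c * M := by
      have h3 : (2 * Real.pi * Complex.I : ℂ) ≠ 0 := Complex.two_pi_I_ne_zero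
      rw [mul_comm (c : ℂ)] at hc
      have h4 := mul_left_cancel₀ h3 hc
      rw [← h4]
      field_simp
    have h5 : k = c * M := by exact_mod_cast h2
    exact hk (Int.eq_zero_of_abs_lt_dvd ⟨c, by rw [h5, mul_comm]⟩ hM)
  rw [Finset.sum_congr rfl h1, geom_sum_eq hz1, hzM, sub_self, zero_div]

theorem norm_exp_sub_exp_le (k : ℤ) (x y : ℝ) :
    ‖Complex.exp (2 * Real.pi * Complex.I * k * x) - Complex.exp (2 * Real.pi * Complex.I * k * y)‖
      ≤ 2 * Real.pi * |(k : ℝ)| * |x - y| := by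
  have h1 : Complex.exp (2 * Real.pi * Complex.I * k * x)
      - Complex.exp (2 * Real.pi * Complex.I * k * y)
      = Complex.exp ((2 * Real.pi * k * y : ℝ) * Complex.I)
        * (Complex.exp (Complex.I * (2 * Real.pi * k * (x - y) : ℝ)) - 1) := by
    rw [mul_sub, mul_one, ← Complex.exp_add]
    push_cast
    ring_nf
  rw [h1, norm_mul, Complex.norm_exp_ofReal_mul_I, one_mul]
  refine (Real.norm_exp_I_mul_ofReal_sub_one_le).trans ?_
  rw [Real.norm_eq_abs, abs_mul, abs_mul, abs_mul, abs_of_pos Real.pi_pos]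
  simp

variable {ι : Type u} {α : Type v} {l : Filter ι} {S : ι → Finset α} {w y : ι → α → ℝ}

/-- If a total mass of `1` in `[0,1)` puts mass at least `1/M - ε` on each interval
`[p/M, (p+1)/M)`, then its exponential means are small. -/
theorem norm_sum_mul_exp_le {S : Finset α} {w y : α → ℝ} (hw : ∀ m ∈ S, 0 ≤ w m)
    (hw1 : ∑ m ∈ S, w m = 1) (hy : ∀ m ∈ S, y m ∈ Set.Ico 0 1) {k : ℤ} (hk : k ≠ 0) {M : ℕ}
    (hM : |k| < M) {ε : ℝ} (hε : 0 ≤ ε)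
    (h : ∀ p < M, 1 / (M : ℝ) - ε ≤ ∑ m ∈ S with ⌊M * y m⌋₊ = p, w m) :
    ‖∑ m ∈ S, (w m : ℂ) * Complex.exp (2 * Real.pi * Complex.I * k * y m)‖
      ≤ 2 * Real.pi * |(k : ℝ)| / M + 2 * M * ε := by
  have hM0 : (0 : ℝ) < M := by
    have : (0 : ℤ) < M := (abs_nonneg k).trans_lt hM
    exact_mod_cast this
  set e : ℝ → ℂ := fun t => Complex.exp (2 * Real.pi * Complex.I * k * t) with he
  have he1 : ∀ t, ‖e t‖ = 1 := fun t => by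
    have : e t = Complex.exp ((2 * Real.pi * k * t : ℝ) * Complex.I) := by
      simp only [he]
      push_cast
      ring_nf
    rw [this, Complex.norm_exp_ofReal_mul_I]
  have hmaps : ∀ m ∈ S, ⌊M * y m⌋₊ ∈ Finset.range M := fun m hm => by
    rw [Finset.mem_range, Nat.floor_lt (mul_nonneg hM0.le (hy m hm).1)]
    nlinarith [(hy m hm).2]
  set W : ℕ → ℝ := fun p => ∑ m ∈ S with ⌊M * y m⌋₊ = p, w m with hW
  have hWsum : ∑ p ∈ Finset.range M, W p = 1 := by
    rw [hW, Finset.sum_fiberwise_of_maps_to hmaps, hw1]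
  have hWe : ∑ m ∈ S, (w m : ℂ) * e ((⌊M * y m⌋₊ : ℝ) / M)
      = ∑ p ∈ Finset.range M, ((W p - 1 / M : ℝ) : ℂ) * e ((p : ℝ) / M) := by
    have h0 : ∑ p ∈ Finset.range M, ((1 / M : ℝ) : ℂ) * e ((p : ℝ) / M) = 0 := by
      rw [← Finset.mul_sum, sum_range_exp_div_eq_zero hk hM, mul_zero]
    rw [← Finset.sum_fiberwise_of_maps_to hmaps, ← sub_zero (Finset.sum _ _), ← h0,
      ← Finset.sum_sub_distrib]
    refine Finset.sum_congr rfl fun p _ => ?_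
    rw [Complex.ofReal_sub, sub_mul, hW, Complex.ofReal_sum, Finset.sum_mul]
    congr 1
    refine Finset.sum_congr rfl fun m hm => ?_
    rw [(Finset.mem_filter.1 hm).2]
  -- Each point moves to the grid point on its left, by at most `1 / M`. Subtracting the vanishing
  -- uniform grid sum leaves only the deviations `W p - 1 / M`.
  have hsplit : ∑ m ∈ S, (w m : ℂ) * e (y m)
      = ∑ m ∈ S, (w m : ℂ) * (e (y m) - e ((⌊M * y m⌋₊ : ℝ) / M))
        + ∑ p ∈ Finset.range M, ((W p - 1 / M : ℝ) : ℂ) * e ((p : ℝ) / M) := by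
    rw [← hWe, ← Finset.sum_add_distrib]
    exact Finset.sum_congr rfl fun m _ => by ring
  have hb1 : ‖∑ m ∈ S, (w m : ℂ) * (e (y m) - e ((⌊M * y m⌋₊ : ℝ) / M))‖
      ≤ 2 * Real.pi * |(k : ℝ)| / M := by
    refine (norm_sum_mul_le (C := 2 * Real.pi * |(k : ℝ)| / M) hw fun m hm => ?_).trans
      (by rw [hw1, mul_one])
    refine (norm_exp_sub_exp_le k _ _).trans ?_
    rw [div_eq_mul_one_div (2 * Real.pi * |(k : ℝ)|)]
    refine mul_le_mul_of_nonneg_left ?_ (by positivity)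
    have h1 := Nat.floor_le (mul_nonneg hM0.le (hy m hm).1)
    have h2 := Nat.lt_floor_add_one (M * y m)
    have h3 : y m - (⌊M * y m⌋₊ : ℝ) / M = (M * y m - ⌊M * y m⌋₊) / M := by
      field_simp
    rw [h3, abs_of_nonneg (div_nonneg (by linarith) hM0.le)]
    exact div_le_div_of_nonneg_right (by linarith) hM0.le
  have hb2 : ‖∑ p ∈ Finset.range M, ((W p - 1 / M : ℝ) : ℂ) * e ((p : ℝ) / M)‖ ≤ 2 * M * ε := by
    -- A deviation `t ≥ -ε` satisfies `|t| ≤ t + 2 * ε`, and the deviations sum to `0`: one-sided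
    -- bounds control the total variation.
    have h2 : ∀ p ∈ Finset.range M,
        ‖((W p - 1 / M : ℝ) : ℂ) * e ((p : ℝ) / M)‖ ≤ W p - 1 / M + 2 * ε := fun p hp => by
      rw [norm_mul, he1, mul_one, Complex.norm_real, Real.norm_eq_abs, abs_le]
      have := h p (Finset.mem_range.1 hp)
      simp only [hW]
      constructor <;> linarith
    refine (norm_sum_le_of_le _ h2).trans ?_
    rw [Finset.sum_add_distrib, Finset.sum_sub_distrib, hWsum]
    simp only [Finset.sum_const, Finset.card_range, nsmul_eq_mul]
    rw [mul_one_div_cancel hM0.ne']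
    linarith
  rw [hsplit]
  exact (norm_add_le _ _).trans (add_le_add hb1 hb2)

/-- If asymptotically each interval carries at least a mass equal to its length, then all
exponential means tend to `0`. -/
theorem tendsto_sum_mul_exp_of_le
    (hw : ∀ᶠ i in l, ∀ m ∈ S i, 0 ≤ w i m) (hw1 : ∀ᶠ i in l, ∑ m ∈ S i, w i m = 1)
    (hy : ∀ᶠ i in l, ∀ m ∈ S i, y i m ∈ Set.Ico 0 1)
    (h : ∀ a b : ℝ, 0 < a → a < b → b < 1 → ∀ ε > 0, ∀ᶠ i in l,
      b - a - ε ≤ ∑ m ∈ S i with a ≤ y i m ∧ y i m < b, w i m)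
    {k : ℤ} (hk : k ≠ 0) :
    Tendsto (fun i => ∑ m ∈ S i, (w i m : ℂ) * Complex.exp (2 * Real.pi * Complex.I * k * y i m))
      l (𝓝 0) := by
  have hgrid : ∀ M : ℕ, 0 < M → ∀ p < M, ∀ ε > 0, ∀ᶠ i in l,
      1 / (M : ℝ) - ε ≤ ∑ m ∈ S i with ⌊M * y i m⌋₊ = p, w i m := by
    intro M hM p hp ε hε
    have hM0 : (0 : ℝ) < M := by exact_mod_cast hM
    -- Trimming by `d` at both ends brings the endpoints strictly inside `(0, 1)`. The term `ε / 4`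
    -- limits the lost length to `ε / 2`, and `1 / (4 * M)` keeps the interval nondegenerate.
    set d : ℝ := min (ε / 4) (1 / (4 * M)) with hd
    have hd0 : 0 < d := by positivity
    have hd1 : d ≤ ε / 4 := min_le_left _ _
    have hd2 : d * M ≤ 1 / 4 := by
      calc d * M ≤ 1 / (4 * M) * M := by gcongr; exact min_le_right _ _
        _ = 1 / 4 := by field_simp
    have hpM : (p : ℝ) + 1 ≤ M := by exact_mod_cast hp
    have e1 : ((p + 1 : ℝ) / M - d) - ((p : ℝ) / M + d) = (1 - 2 * (d * M)) / M := by
      field_simp; ring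
    have := h (p / M + d) ((p + 1) / M - d) (by positivity)
      (by rw [← sub_pos, e1]; exact div_pos (by linarith) hM0)
      (by linarith [(div_le_one hM0).2 hpM]) (ε / 2) (by positivity)
    filter_upwards [this, hw] with i hi hwi
    have e2 : ((p + 1 : ℝ) / M - d) - ((p : ℝ) / M + d) = 1 / M - 2 * d := by ring
    rw [e2] at hi
    refine le_trans (by linarith) (hi.trans (Finset.sum_le_sum_of_subset_of_nonneg ?_ ?_))
    · intro m hm
      simp only [Finset.mem_filter] at hm ⊢
      obtain ⟨hm, h1, h2⟩ := hm
      refine ⟨hm, ?_⟩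
      have h3 : (p : ℝ) / M ≤ y i m := by linarith
      have h4 : y i m < ((p : ℝ) + 1) / M := by linarith
      rw [div_le_iff₀ hM0] at h3
      rw [lt_div_iff₀ hM0] at h4
      rw [Nat.floor_eq_iff (by nlinarith [p.cast_nonneg (α := ℝ)])]
      constructor <;> linarith
    · exact fun m hm _ => hwi m (Finset.mem_filter.1 hm).1
  rw [Metric.tendsto_nhds]
  intro ε hε
  -- The first bound annihilates the grid sum, the second makes the displacement error less than `ε
  -- / 2`. The tolerance `ε / (4 * M)` below makes the deviation error exactly `ε / 2`.
  obtain ⟨M, hM⟩ := exists_nat_gt (max (|(k : ℝ)|) (2 * Real.pi * |(k : ℝ)| / (ε / 2)))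
  have hkM : |k| < M := by
    have := (le_max_left _ _).trans_lt hM
    exact_mod_cast this
  have hM0 : (0 : ℝ) < M := (abs_nonneg _).trans_lt ((le_max_left _ _).trans_lt hM)
  have hM1 : 2 * Real.pi * |(k : ℝ)| / M < ε / 2 := by
    have := (le_max_right _ _).trans_lt hM
    rw [div_lt_iff₀ (by positivity)] at this
    rw [div_lt_iff₀ hM0]
    linarith
  have hall : ∀ᶠ i in l, ∀ p < M,
      1 / (M : ℝ) - ε / (4 * M) ≤ ∑ m ∈ S i with ⌊M * y i m⌋₊ = p, w i m :=
    (Set.finite_lt_nat M).eventually_all.2 fun p hp =>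
      hgrid M (by exact_mod_cast hM0) p hp _ (by positivity)
  filter_upwards [hw, hw1, hy, hall] with i h1 h2 h3 h4
  have := norm_sum_mul_exp_le h1 h2 h3 hk hkM (by positivity) h4
  rw [dist_zero_right]
  refine this.trans_lt ?_
  have : 2 * M * (ε / (4 * M)) = ε / 2 := by field_simp; norm_num
  linarith

end Grid

/-! ### Standard parts as limits along the ultrafilter -/

section StdPart

variable {ι : Type u} {U : Ultrafilter ι}

variable (U) in
/-- The diagonal embedding `ℝ → *ℝ`. -/
def constOrderRingHom : ℝ →+*o Star U ℝ where
  toFun r := (Germ.const r : Star U ℝ)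
  map_one' := rfl
  map_zero' := rfl
  map_add' _ _ := rfl
  map_mul' _ _ := rfl
  monotone' _ _ h := Germ.const_le h

theorem stdPart_coe_of_tendsto {d : ι → ℝ} {r : ℝ} (h : Tendsto d U (𝓝 r)) :
    ArchimedeanClass.stdPart (d : Star U ℝ) = r := by
  refine ArchimedeanClass.stdPart_eq (constOrderRingHom U) (fun s hs => ?_) (fun s hs => ?_)
  · exact Germ.coe_le.2 (((tendsto_order.1 h).1 s hs).mono fun _ => le_of_lt)
  · exact Germ.coe_le.2 (((tendsto_order.1 h).2 s hs).mono fun _ => le_of_lt)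

theorem exists_tendsto_of_eventually_mem_Icc {d : ι → ℝ} {a b : ℝ}
    (h : ∀ᶠ i in (U : Filter ι), d i ∈ Set.Icc a b) :
    ∃ r ∈ Set.Icc a b, Tendsto d U (𝓝 r) :=
  isCompact_Icc.ultrafilter_le_nhds (U.map d) (le_principal_iff.2 h)

end StdPart

/-! ### Cells, their masses, and saturation -/

section Cells

theorem stdCellMass_nonneg (n : ℕ) (f : ℕ → ℝ) (j : ℕ) : 0 ≤ stdCellMass n f j := by
  unfold stdCellMass
  positivity

theorem floor_mul_eq_iff {n : ℕ} (hn : 0 < n) {x : ℝ} (hx : 0 ≤ x) {j : ℕ} :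
    ⌊n * x⌋₊ = j ↔ (j : ℝ) / n ≤ x ∧ x < ((j : ℝ) + 1) / n := by
  have hn' : (0 : ℝ) < n := by exact_mod_cast hn
  rw [Nat.floor_eq_iff (by positivity), div_le_iff₀ hn', lt_div_iff₀ hn', mul_comm]

theorem floor_mul_lt {n : ℕ} (hn : 0 < n) {x : ℝ} (hx : x ∈ Set.Ico 0 1) : ⌊n * x⌋₊ < n := by
  have hn' : (0 : ℝ) < n := by exact_mod_cast hn
  rw [Nat.floor_lt (mul_nonneg hn'.le hx.1)]
  nlinarith [hx.2]

/-- Sorts the sample by cell, on which the summand is constant. This serves both for the total mass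
and for the Weyl means. -/
theorem sum_stdCellMass_mul {n : ℕ} (hn : 0 < n) {f : ℕ → ℝ}
    (hf : ∀ j ∈ Finset.Icc 1 n, f j ∈ Set.Ico 0 1) (φ : ℕ → ℂ) :
    ∑ m ∈ Finset.range n, (stdCellMass n f m : ℂ) * φ m
      = 1 / n * ∑ j ∈ Finset.Icc 1 n, φ ⌊n * f j⌋₊ := by
  rw [← Finset.sum_fiberwise_of_maps_to (t := Finset.range n) (g := fun j => ⌊n * f j⌋₊)
    (fun j hj => Finset.mem_range.2 (floor_mul_lt hn (hf j hj))), Finset.mul_sum]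
  refine Finset.sum_congr rfl fun m _ => ?_
  have h1 : ∑ j ∈ Finset.Icc 1 n with ⌊n * f j⌋₊ = m, φ ⌊n * f j⌋₊
      = ∑ j ∈ Finset.Icc 1 n with ⌊n * f j⌋₊ = m, φ m :=
    Finset.sum_congr rfl fun j hj => by rw [(Finset.mem_filter.1 hj).2]
  have h2 : (Finset.Icc 1 n).filter (fun j => ⌊n * f j⌋₊ = m) = (Finset.Icc 1 n).filter
      fun j => (m : ℝ) / n ≤ f j ∧ f j < ((m : ℝ) + 1) / n :=
    Finset.filter_congr fun j hj => floor_mul_eq_iff hn (hf j hj).1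
  rw [h1, Finset.sum_const, h2, nsmul_eq_mul, stdCellMass]
  push_cast
  ring

theorem sum_range_stdCellMass {n : ℕ} (hn : 0 < n) {f : ℕ → ℝ}
    (hf : ∀ j ∈ Finset.Icc 1 n, f j ∈ Set.Ico 0 1) :
    ∑ m ∈ Finset.range n, stdCellMass n f m = 1 := by
  have h := sum_stdCellMass_mul hn hf fun _ => 1
  have hn' : (n : ℂ) ≠ 0 := by exact_mod_cast hn.ne'
  simp only [mul_one, Finset.sum_const, Nat.card_Icc, Nat.add_sub_cancel, nsmul_eq_mul,
    one_div, inv_mul_cancel₀ hn'] at h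
  exact_mod_cast h

variable {ι : Type u} {U : Ultrafilter ι} {n : ι → ℕ} {g : ι → ℕ → ℝ}

/-- `g` represents an internal sequence of infinite length `n`, with values in `*[0,1)`. -/
structure IsSample (U : Ultrafilter ι) (n : ι → ℕ) (g : ι → ℕ → ℝ) : Prop where
  tendsto : Tendsto n U atTop
  mem : ∀ᶠ i in (U : Filter ι), ∀ j ∈ Finset.Icc 1 (n i), g i j ∈ Set.Ico 0 1

theorem IsSample.pos (h : IsSample U n g) : ∀ᶠ i in (U : Filter ι), 0 < n i :=
  h.tendsto.eventually_gt_atTop 0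

theorem IsSample.sum_eq_one (h : IsSample U n g) :
    ∀ᶠ i in (U : Filter ι), ∑ m ∈ Finset.range (n i), stdCellMass (n i) (g i) m = 1 := by
  filter_upwards [h.pos, h.mem] with i h1 h2 using sum_range_stdCellMass h1 h2

theorem isIndexSet_coe {J : ι → Finset ℕ} :
    IsIndexSet (n : Star U ℕ) (J : Star U (Finset ℕ)) ↔
      ∀ᶠ i in (U : Filter ι), J i ⊆ Finset.range (n i) :=
  Germ.coe_le

theorem delta_coe (J : ι → Finset ℕ) :
    delta (n : Star U ℕ) (g : Star U (ℕ → ℝ)) (J : Star U (Finset ℕ))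
      = ((fun i => ∑ m ∈ J i, stdCellMass (n i) (g i) m : ι → ℝ) : Star U ℝ) :=
  rfl

/-- The masses lie in `[0, 1]`, so compactness gives a limit along the ultrafilter, which is the
standard part. Loeb values are computed through this limit. -/
theorem IsSample.tendsto_delta (h : IsSample U n g) {J : ι → Finset ℕ}
    (hJ : ∀ᶠ i in (U : Filter ι), J i ⊆ Finset.range (n i)) :
    Tendsto (fun i => ∑ m ∈ J i, stdCellMass (n i) (g i) m) U
      (𝓝 (ArchimedeanClass.stdPart (delta (n : Star U ℕ) (g : Star U (ℕ → ℝ))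
        (J : Star U (Finset ℕ))))) := by
  obtain ⟨r, -, hr⟩ := exists_tendsto_of_eventually_mem_Icc (a := 0) (b := 1)
    (d := fun i => ∑ m ∈ J i, stdCellMass (n i) (g i) m) (U := U) <| by
      filter_upwards [hJ, h.sum_eq_one] with i h1 h2
      refine ⟨Finset.sum_nonneg fun m _ => stdCellMass_nonneg _ _ _, ?_⟩
      rw [← h2]
      exact Finset.sum_le_sum_of_subset_of_nonneg h1 fun m _ _ => stdCellMass_nonneg _ _ _
  rwa [delta_coe, stdPart_coe_of_tendsto hr]

theorem StarUnit.exists_rep (x : StarUnit U) :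
    ∃ f : ι → ℝ, (x : Star U ℝ) = (f : Star U ℝ) ∧
      ∀ᶠ i in (U : Filter ι), f i ∈ Set.Ico (0 : ℝ) 1 := by
  obtain ⟨x, hx⟩ := x
  induction x using Germ.inductionOn with
  | _ f => exact ⟨f, rfl, (Germ.coe_le.1 hx.1).and (Germ.coe_lt.1 hx.2)⟩

/-- The only cell containing `x` has index `⌊ηx⌋`, so set operations on unions of cells reduce to
operations on their index sets. -/
theorem mem_cellUnion_coe (hn : ∀ᶠ i in (U : Filter ι), 0 < n i) {x : StarUnit U} {f : ι → ℝ}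
    (hx : (x : Star U ℝ) = (f : Star U ℝ)) {J : ι → Finset ℕ} :
    x ∈ cellUnion (n : Star U ℕ) (J : Star U (Finset ℕ)) ↔
      ∀ᶠ i in (U : Filter ι), ⌊n i * f i⌋₊ ∈ J i := by
  have h0 : ∀ᶠ i in (U : Filter ι), 0 ≤ f i := Germ.coe_le.1 (hx ▸ x.2.1)
  have hcell : ∀ j : ι → ℕ, x ∈ cell (n : Star U ℕ) (j : Star U ℕ) ↔
      ∀ᶠ i in (U : Filter ι), ⌊n i * f i⌋₊ = j i := by
    intro j
    have h1 : x ∈ cell (n : Star U ℕ) (j : Star U ℕ) ↔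
        ((fun i => (j i : ℝ) / n i : ι → ℝ) : Star U ℝ) ≤ (f : Star U ℝ) ∧
        (f : Star U ℝ) < ((fun i => ((j i : ℝ) + 1) / n i : ι → ℝ) : Star U ℝ) := by
      rw [← hx]
      rfl
    rw [h1, Germ.coe_le, Germ.coe_lt, EventuallyLE, ← eventually_and]
    refine eventually_congr ?_
    filter_upwards [hn, h0] with i h2 h3 using (floor_mul_eq_iff h2 h3).symm
  constructor
  · rintro ⟨j, hj, hxj⟩
    induction j using Germ.inductionOn with
    | _ j =>
      have hj' : ∀ᶠ i in (U : Filter ι), j i ∈ J i := hj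
      filter_upwards [hj', (hcell j).1 hxj] with i h1 h2
      rwa [h2]
  · intro h
    exact ⟨((fun i => ⌊n i * f i⌋₊ : ι → ℕ) : Star U ℕ), h,
      (hcell _).2 (Eventually.of_forall fun _ => rfl)⟩

/-- Saturation: an internal union of cells covered by countably many internal unions of cells is
covered by finitely many of them. -/
theorem exists_subset_biUnion_of_subset_iUnion (hn : Tendsto n U atTop) {J : ι → Finset ℕ}
    (hJ : ∀ᶠ i in (U : Filter ι), J i ⊆ Finset.range (n i)) {K : ℕ → ι → Finset ℕ}
    (h : cellUnion (n : Star U ℕ) (J : Star U (Finset ℕ)) ⊆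
      ⋃ k, cellUnion (n : Star U ℕ) (K k : Star U (Finset ℕ))) :
    ∃ N, ∀ᶠ i in (U : Filter ι), J i ⊆ (Finset.range N).biUnion fun k => K k i := by
  classical
  by_contra! hcon
  -- Diagonal choice: `N i` is the largest number of covering sets, capped by `n i`, that still miss
  -- an index of `J i`. As `n` diverges, `N` eventually exceeds every standard bound, so a missed
  -- index `m i` avoids every `K k`. The left endpoint `m i / n i` then represents an uncovered
  -- point.
  set N : ι → ℕ := fun i => Nat.findGreatest
    (fun N => ¬ J i ⊆ (Finset.range N).biUnion fun k => K k i) (n i) with hN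
  -- The guard says that `J i` is nonempty; elsewhere `m i` is the dummy value `0`.
  have hex : ∀ i, ∃ m, (¬ J i ⊆ (Finset.range 0).biUnion fun k => K k i) →
      m ∈ J i ∧ m ∉ (Finset.range (N i)).biUnion fun k => K k i := by
    intro i
    by_cases h0 : ¬ J i ⊆ (Finset.range 0).biUnion fun k => K k i
    · have h1 := Nat.findGreatest_spec (P := fun N =>
        ¬ J i ⊆ (Finset.range N).biUnion fun k => K k i) (Nat.zero_le (n i)) h0
      obtain ⟨m, hm⟩ := Finset.not_subset.1 h1
      exact ⟨m, fun _ => hm⟩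
    · exact ⟨0, fun h => absurd h h0⟩
  choose m hm using hex
  have hpos : ∀ᶠ i in (U : Filter ι), 0 < n i := hn.eventually_gt_atTop 0
  have hfloor : ∀ᶠ i in (U : Filter ι), ⌊n i * ((m i : ℝ) / n i)⌋₊ = m i := by
    filter_upwards [hpos] with i hi
    have : (n i : ℝ) ≠ 0 := by exact_mod_cast hi.ne'
    rw [mul_div_cancel₀ _ this, Nat.floor_natCast]
  have hmem : ((fun i => (m i : ℝ) / n i : ι → ℝ) : Star U ℝ) ∈ Set.Ico (0 : Star U ℝ) 1 := by
    refine ⟨Germ.coe_le.2 (Eventually.of_forall fun i => by positivity), Germ.coe_lt.2 ?_⟩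
    filter_upwards [hpos, hJ, hcon 0] with i h1 h2 h3
    have h4 := Finset.mem_range.1 (h2 (hm i h3).1)
    rw [div_lt_one (by exact_mod_cast h1)]
    exact_mod_cast h4
  have hx : (⟨_, hmem⟩ : StarUnit U) ∈ cellUnion (n : Star U ℕ) (J : Star U (Finset ℕ)) := by
    rw [mem_cellUnion_coe hpos rfl]
    filter_upwards [hfloor, hcon 0] with i h1 h2
    rw [h1]
    exact (hm i h2).1
  obtain ⟨k, hk⟩ := Set.mem_iUnion.1 (h hx)
  rw [mem_cellUnion_coe hpos rfl] at hk
  obtain ⟨i, h1, h2, h3, h4, h5⟩ := (hk.and (hfloor.and ((hcon 0).and ((hcon (k + 1)).and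
    (hn.eventually_ge_atTop (k + 1)))))).exists
  rw [h2] at h1
  have h6 : k + 1 ≤ N i := Nat.le_findGreatest h5 h4
  exact (hm i h3).2 (Finset.mem_biUnion.2 ⟨k, Finset.mem_range.2 h6, h1⟩)

theorem eventually_subset_of_cellUnion_subset (hn : Tendsto n U atTop) {J K : ι → Finset ℕ}
    (hJ : ∀ᶠ i in (U : Filter ι), J i ⊆ Finset.range (n i))
    (h : cellUnion (n : Star U ℕ) (J : Star U (Finset ℕ)) ⊆
      cellUnion (n : Star U ℕ) (K : Star U (Finset ℕ))) :
    ∀ᶠ i in (U : Filter ι), J i ⊆ K i := by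
  obtain ⟨N, hN⟩ := exists_subset_biUnion_of_subset_iUnion hn hJ (K := fun _ => K)
    (h.trans (Set.subset_iUnion (fun _ : ℕ => cellUnion (n : Star U ℕ) (K : Star U (Finset ℕ))) 0))
  filter_upwards [hN] with i hi m hm
  obtain ⟨_, _, h⟩ := Finset.mem_biUnion.1 (hi hm)
  exact h

end Cells

/-! ### Loeb measurability and total mass -/

section LoebMeasure

variable {ι : Type u} {U : Ultrafilter ι} {n : ι → ℕ} {g : ι → ℕ → ℝ}

theorem loebOuter_cellUnion_le {η : Star U ℕ} (s : Star U (ℕ → ℝ)) {J : Star U (Finset ℕ)}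
    (hJ : IsIndexSet η J) :
    loebOuter η s (cellUnion η J) ≤ ENNReal.ofReal (ArchimedeanClass.stdPart (delta η s J)) :=
  (OuterMeasure.ofFunction_le _).trans (iInf₂_le J ⟨hJ, rfl⟩)

theorem loebMeasure_apply {η : Star U ℕ} {s : Star U (ℕ → ℝ)} {A : Set (StarUnit U)}
    (hA : MeasurableSet[loebAlgebra η s] A) : loebMeasure η s A = loebOuter η s A :=
  @toMeasure_apply _ (loebAlgebra η s) _ le_rfl _ hA

/-- Completeness is what admits intervals, which need not be unions of cells. -/
theorem measurableSet_loebAlgebra_of_null {η : Star U ℕ} {s : Star U (ℕ → ℝ)}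
    {A : Set (StarUnit U)} (hA : loebOuter η s A = 0) : MeasurableSet[loebAlgebra η s] A := by
  refine (OuterMeasure.isCaratheodory_iff_le _).2 fun t => ?_
  have h1 : loebOuter η s (t ∩ A) = 0 :=
    le_antisymm (((loebOuter η s).mono Set.inter_subset_right).trans hA.le) bot_le
  rw [h1, zero_add]
  exact (loebOuter η s).mono Set.sdiff_subset

/-- It suffices to test against the premeasure. Sets outside the algebra have value `∞`, and on the
algebra the splitting is additivity of limits along `U`. -/
theorem IsSample.measurableSet_cellUnion (h : IsSample U n g) (K : ι → Finset ℕ) :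
    MeasurableSet[loebAlgebra (n : Star U ℕ) (g : Star U (ℕ → ℝ))]
      (cellUnion (n : Star U ℕ) (K : Star U (Finset ℕ))) := by
  classical
  refine OuterMeasure.ofFunction_caratheodory fun t => le_iInf₂ fun J hJ => ?_
  induction J using Germ.inductionOn with
  | _ J =>
    obtain ⟨hJ, rfl⟩ := hJ
    rw [isIndexSet_coe] at hJ
    have h1 : cellUnion (n : Star U ℕ) (J : Star U (Finset ℕ)) ∩ cellUnion n (K : Star U (Finset ℕ))
        = cellUnion n ((fun i => J i ∩ K i : ι → Finset ℕ) : Star U (Finset ℕ)) := by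
      ext x
      obtain ⟨f, hf, -⟩ := StarUnit.exists_rep x
      rw [Set.mem_inter_iff, mem_cellUnion_coe h.pos hf, mem_cellUnion_coe h.pos hf,
        mem_cellUnion_coe h.pos hf, ← eventually_and]
      simp only [Finset.mem_inter]
    have h2 : cellUnion (n : Star U ℕ) (J : Star U (Finset ℕ)) \ cellUnion n (K : Star U (Finset ℕ))
        = cellUnion n ((fun i => J i \ K i : ι → Finset ℕ) : Star U (Finset ℕ)) := by
      ext x
      obtain ⟨f, hf, -⟩ := StarUnit.exists_rep x
      rw [Set.mem_sdiff, mem_cellUnion_coe h.pos hf, mem_cellUnion_coe h.pos hf,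
        mem_cellUnion_coe h.pos hf, ← Ultrafilter.eventually_not, ← eventually_and]
      simp only [Finset.mem_sdiff]
    have hI : ∀ᶠ i in (U : Filter ι), J i ∩ K i ⊆ Finset.range (n i) :=
      hJ.mono fun i hi => Finset.inter_subset_left.trans hi
    have hD : ∀ᶠ i in (U : Filter ι), J i \ K i ⊆ Finset.range (n i) :=
      hJ.mono fun i hi => Finset.sdiff_subset.trans hi
    have hadd := tendsto_nhds_unique (h.tendsto_delta hJ)
      (((h.tendsto_delta hI).add (h.tendsto_delta hD)).congr fun i => by
        rw [add_comm, ← Finset.sum_union (Finset.disjoint_sdiff_inter _ _),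
          Finset.sdiff_union_inter])
    have hnn : ∀ A : ι → Finset ℕ, (∀ᶠ i in (U : Filter ι), A i ⊆ Finset.range (n i)) →
        0 ≤ ArchimedeanClass.stdPart (delta (n : Star U ℕ) (g : Star U (ℕ → ℝ))
          (A : Star U (Finset ℕ))) := fun A hA =>
      ge_of_tendsto' (h.tendsto_delta hA) fun i =>
        Finset.sum_nonneg fun m _ => stdCellMass_nonneg _ _ _
    rw [h1, h2, hadd, ENNReal.ofReal_add (hnn _ hI) (hnn _ hD)]
    exact add_le_add (iInf₂_le _ ⟨isIndexSet_coe.2 hI, rfl⟩) (iInf₂_le _ ⟨isIndexSet_coe.2 hD, rfl⟩)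

/-- A union of cells determines its index set `U`-almost everywhere, so no other representation in
the infimum has smaller mass. -/
theorem IsSample.le_loebPremeasure (h : IsSample U n g) {J : ι → Finset ℕ}
    (hJ : ∀ᶠ i in (U : Filter ι), J i ⊆ Finset.range (n i)) :
    ENNReal.ofReal (ArchimedeanClass.stdPart (delta (n : Star U ℕ) (g : Star U (ℕ → ℝ))
      (J : Star U (Finset ℕ)))) ≤
      loebPremeasure n g (cellUnion (n : Star U ℕ) (J : Star U (Finset ℕ))) := by
  refine le_iInf₂ fun K hK => ?_
  induction K using Germ.inductionOn with
  | _ K =>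
    refine ENNReal.ofReal_le_ofReal (le_of_tendsto_of_tendsto (h.tendsto_delta hJ)
      (h.tendsto_delta (isIndexSet_coe.1 hK.1)) ?_)
    filter_upwards [eventually_subset_of_cellUnion_subset h.tendsto hJ hK.2.subset] with i hi
    exact Finset.sum_le_sum_of_subset_of_nonneg hi fun m _ _ => stdCellMass_nonneg _ _ _

theorem sum_biUnion_range_le {w : ℕ → ℝ} (K : ℕ → Finset ℕ) (hw : ∀ m, 0 ≤ w m) (N : ℕ) :
    ∑ m ∈ (Finset.range N).biUnion K, w m ≤ ∑ k ∈ Finset.range N, ∑ m ∈ K k, w m := by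
  induction N with
  | zero => simp
  | succ N ih =>
    rw [Finset.range_add_one, Finset.biUnion_insert, Finset.sum_insert Finset.notMem_range_self]
    have h1 := Finset.sum_union_inter (s₁ := K N) (s₂ := (Finset.range N).biUnion K) (f := w)
    have h2 : 0 ≤ ∑ m ∈ K N ∩ (Finset.range N).biUnion K, w m := Finset.sum_nonneg fun m _ => hw m
    linarith

/-- By saturation, the Loeb measure of `*[0,1)` is not smaller than its counting measure. -/
theorem IsSample.one_le_loebOuter_univ (h : IsSample U n g) :
    1 ≤ loebOuter (n : Star U ℕ) (g : Star U (ℕ → ℝ)) Set.univ := by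
  classical
  refine le_iInf₂ fun t ht => ?_
  by_cases htop : ∃ k, loebPremeasure (n : Star U ℕ) (g : Star U (ℕ → ℝ)) (t k) = ⊤
  · obtain ⟨k, hk⟩ := htop
    exact le_top.trans (hk.ge.trans (ENNReal.le_tsum k))
  push Not at htop
  have hex : ∀ k, ∃ J : ι → Finset ℕ, (∀ᶠ i in (U : Filter ι), J i ⊆ Finset.range (n i)) ∧
      t k = cellUnion (n : Star U ℕ) (J : Star U (Finset ℕ)) := by
    intro k
    by_contra! hcon
    refine htop k (iInf₂_eq_top.2 fun J hJ => ?_)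
    induction J using Germ.inductionOn with
    | _ J => exact absurd hJ.2 (hcon J (isIndexSet_coe.1 hJ.1))
  choose J hJ htJ using hex
  -- All covering sets are now internal, so finitely many suffice, and finite subadditivity passes
  -- to the limit.
  obtain ⟨N, hN⟩ := exists_subset_biUnion_of_subset_iUnion h.tendsto
    (J := fun i => Finset.range (n i)) (K := J) (Eventually.of_forall fun _ => subset_rfl) (by
      simp only [← htJ]
      exact (Set.subset_univ _).trans ht)
  have hlim := tendsto_finsetSum (Finset.range N) fun k _ => h.tendsto_delta (hJ k)
  have h1 := ge_of_tendsto (b := (1 : ℝ)) hlim <| by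
    filter_upwards [hN, h.sum_eq_one] with i h1 h2
    rw [← h2]
    refine (Finset.sum_le_sum_of_subset_of_nonneg h1 fun m _ _ => stdCellMass_nonneg _ _ _).trans ?_
    exact sum_biUnion_range_le _ (stdCellMass_nonneg _ _) N
  calc (1 : ℝ≥0∞) = ENNReal.ofReal 1 := ENNReal.ofReal_one.symm
    _ ≤ ENNReal.ofReal (∑ k ∈ Finset.range N, ArchimedeanClass.stdPart
          (delta (n : Star U ℕ) (g : Star U (ℕ → ℝ)) (J k : Star U (Finset ℕ)))) :=
        ENNReal.ofReal_le_ofReal h1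
    _ = ∑ k ∈ Finset.range N, ENNReal.ofReal (ArchimedeanClass.stdPart
          (delta (n : Star U ℕ) (g : Star U (ℕ → ℝ)) (J k : Star U (Finset ℕ)))) :=
        ENNReal.ofReal_sum_of_nonneg fun k _ => ge_of_tendsto' (h.tendsto_delta (hJ k)) fun i =>
          Finset.sum_nonneg fun m _ => stdCellMass_nonneg _ _ _
    _ ≤ ∑ k ∈ Finset.range N, loebPremeasure (n : Star U ℕ) (g : Star U (ℕ → ℝ)) (t k) :=
        Finset.sum_le_sum fun k _ => by
          rw [htJ k]
          exact h.le_loebPremeasure (hJ k)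
    _ ≤ _ := ENNReal.sum_le_tsum _

end LoebMeasure

/-! ### The two implications for representatives -/

section Equidistribution

variable {ι : Type u} {U : Ultrafilter ι} {n : ι → ℕ} {g : ι → ℕ → ℝ}

/-- The exponential mean of the cell masses at the left endpoints of the cells. -/
def cellMean (n : ℕ) (f : ℕ → ℝ) (k : ℤ) : ℂ :=
  ∑ m ∈ Finset.range n,
    (stdCellMass n f m : ℂ) * Complex.exp (2 * Real.pi * Complex.I * k * ((m : ℝ) / n : ℝ))

theorem tendsto_floor_mul_div (hn : Tendsto n U atTop) {f : ι → ℝ} {r : ℝ}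
    (hf : ∀ᶠ i in (U : Filter ι), 0 ≤ f i) (hr : Tendsto f U (𝓝 r)) :
    Tendsto (fun i => (⌊n i * f i⌋₊ : ℝ) / n i) U (𝓝 r) := by
  have h1 : Tendsto (fun i => f i - 1 / (n i : ℝ)) U (𝓝 r) := by
    simpa using hr.sub (tendsto_one_div_atTop_nhds_zero_nat.comp hn)
  refine tendsto_of_tendsto_of_tendsto_of_le_of_le' h1 hr ?_ ?_
  · filter_upwards [hn.eventually_gt_atTop 0] with i hi
    have hi' : (0 : ℝ) < n i := by exact_mod_cast hi
    rw [sub_le_iff_le_add, ← add_div, le_div_iff₀ hi', mul_comm]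
    exact (Nat.lt_floor_add_one _).le
  · filter_upwards [hn.eventually_gt_atTop 0, hf] with i hi h0
    have hi' : (0 : ℝ) < n i := by exact_mod_cast hi
    rw [div_le_iff₀ hi', mul_comm (f i)]
    exact Nat.floor_le (by positivity)

/-- The slack `ε` in `hJ'` allows cell endpoints that merely converge to `α` and `β`. The case `α =
β` shows that single cells are null. -/
theorem IsSample.loebOuter_cellUnion_le_length (h : IsSample U n g)
    (hk : ∀ k : ℤ, k ≠ 0 → Tendsto (fun i => cellMean (n i) (g i) k) U (𝓝 0))
    {α β : ℝ} (hαβ : α ≤ β) {J : ι → Finset ℕ}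
    (hJ : ∀ᶠ i in (U : Filter ι), J i ⊆ Finset.range (n i))
    (hJ' : ∀ ε > 0, ∀ᶠ i in (U : Filter ι), ∀ m ∈ J i,
      α - ε ≤ (m : ℝ) / n i ∧ (m : ℝ) / n i ≤ β + ε) :
    loebOuter (n : Star U ℕ) (g : Star U (ℕ → ℝ)) (cellUnion n (J : Star U (Finset ℕ)))
      ≤ ENNReal.ofReal (β - α) := by
  refine (loebOuter_cellUnion_le _ (isIndexSet_coe.2 hJ)).trans (ENNReal.ofReal_le_ofReal ?_)
  refine le_of_forall_pos_le_add fun ε hε => le_of_tendsto (h.tendsto_delta hJ) ?_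
  have h1 := eventually_sum_le_length (l := (U : Filter ι)) (S := fun i => Finset.range (n i))
    (w := fun i => stdCellMass (n i) (g i)) (y := fun i m => (m : ℝ) / n i) (T := J)
    (a := α - ε / 4) (b := β + ε / 4) (by linarith)
    (Eventually.of_forall fun i m _ => stdCellMass_nonneg _ _ _) h.sum_eq_one hk
    (hJ.and (hJ' (ε / 4) (by positivity))) (half_pos hε)
  filter_upwards [h1] with i hi
  linarith

theorem IsSample.weaklyEquidistributed_of_tendsto (h : IsSample U n g)
    (hk : ∀ k : ℤ, k ≠ 0 → Tendsto (fun i => cellMean (n i) (g i) k) U (𝓝 0)) :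
    WeaklyEquidistributed (n : Star U ℕ) (g : Star U (ℕ → ℝ)) := by
  intro a b hab
  obtain ⟨fa, hfa, hfa'⟩ := a.exists_rep
  obtain ⟨fb, hfb, hfb'⟩ := b.exists_rep
  have hfab : ∀ᶠ i in (U : Filter ι), fa i ≤ fb i := by
    have : (a : Star U ℝ) ≤ b := hab
    rw [hfa, hfb] at this
    exact Germ.coe_le.1 this
  obtain ⟨α, hα, hαlim⟩ := exists_tendsto_of_eventually_mem_Icc
    (hfa'.mono fun i hi => Set.Ico_subset_Icc_self hi)
  obtain ⟨β, hβ, hβlim⟩ := exists_tendsto_of_eventually_mem_Icc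
    (hfb'.mono fun i hi => Set.Ico_subset_Icc_self hi)
  have hαβ : α ≤ β := le_of_tendsto_of_tendsto hαlim hβlim hfab
  have hst : ArchimedeanClass.stdPart ((b : Star U ℝ) - (a : Star U ℝ)) = β - α := by
    rw [hfa, hfb]
    exact stdPart_coe_of_tendsto (hβlim.sub hαlim)
  have hA := tendsto_floor_mul_div h.tendsto (hfa'.mono fun i hi => hi.1) hαlim
  have hB := tendsto_floor_mul_div h.tendsto (hfb'.mono fun i hi => hi.1) hβlim
  set A : ι → ℕ := fun i => ⌊n i * fa i⌋₊
  set B : ι → ℕ := fun i => ⌊n i * fb i⌋₊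
  have hAB : ∀ᶠ i in (U : Filter ι), A i ≤ B i := by
    filter_upwards [hfab] with i hi
    exact Nat.floor_le_floor (mul_le_mul_of_nonneg_left hi (Nat.cast_nonneg _))
  have hAn : ∀ᶠ i in (U : Filter ι), A i < n i := by
    filter_upwards [h.pos, hfa'] with i h1 h2 using floor_mul_lt h1 h2
  have hBn : ∀ᶠ i in (U : Filter ι), B i < n i := by
    filter_upwards [h.pos, hfb'] with i h1 h2 using floor_mul_lt h1 h2
  have hAge : ∀ ε > 0, ∀ᶠ i in (U : Filter ι), ∀ m, A i ≤ m → α - ε ≤ (m : ℝ) / n i := by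
    intro ε hε
    filter_upwards [(tendsto_order.1 hA).1 (α - ε) (by linarith)] with i hi m hm
    refine hi.le.trans (div_le_div_of_nonneg_right ?_ (Nat.cast_nonneg _))
    exact_mod_cast hm
  have hBge : ∀ ε > 0, ∀ᶠ i in (U : Filter ι), ∀ m, B i ≤ m → β - ε ≤ (m : ℝ) / n i := by
    intro ε hε
    filter_upwards [(tendsto_order.1 hB).1 (β - ε) (by linarith)] with i hi m hm
    refine hi.le.trans (div_le_div_of_nonneg_right ?_ (Nat.cast_nonneg _))
    exact_mod_cast hm
  have hAle : ∀ ε > 0, ∀ᶠ i in (U : Filter ι), ∀ m, m ≤ A i → (m : ℝ) / n i ≤ α + ε := by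
    intro ε hε
    filter_upwards [(tendsto_order.1 hA).2 (α + ε) (by linarith)] with i hi m hm
    refine le_trans (div_le_div_of_nonneg_right ?_ (Nat.cast_nonneg _)) hi.le
    exact_mod_cast hm
  have hBle : ∀ ε > 0, ∀ᶠ i in (U : Filter ι), ∀ m, m ≤ B i → (m : ℝ) / n i ≤ β + ε := by
    intro ε hε
    filter_upwards [(tendsto_order.1 hB).2 (β + ε) (by linarith)] with i hi m hm
    refine le_trans (div_le_div_of_nonneg_right ?_ (Nat.cast_nonneg _)) hi.le
    exact_mod_cast hm
  -- membership of a point in the interval, through its representatives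
  have hIoo : ∀ {x : StarUnit U} {f : ι → ℝ}, (x : Star U ℝ) = (f : Star U ℝ) →
      (x ∈ Set.Ioo a b ↔ ∀ᶠ i in (U : Filter ι), fa i < f i ∧ f i < fb i) := by
    intro x f hf
    have : x ∈ Set.Ioo a b ↔ (a : Star U ℝ) < x ∧ (x : Star U ℝ) < b := Iff.rfl
    rw [this, hf, hfa, hfb, Germ.coe_lt, Germ.coe_lt, ← eventually_and]
  set μ := loebOuter (n : Star U ℕ) (g : Star U (ℕ → ℝ)) with hμ
  -- `V` and `D` enclose the interval and differ at most by the end cells `CA` and `CB`; `L` and `R`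
  -- cover its complement.
  set V : Set (StarUnit U) := cellUnion n ((fun i => Finset.Ioo (A i) (B i) : ι → Finset ℕ) :
    Star U (Finset ℕ)) with hV
  set CA : Set (StarUnit U) := cellUnion n ((fun i => {A i} : ι → Finset ℕ) :
    Star U (Finset ℕ)) with hCA
  set CB : Set (StarUnit U) := cellUnion n ((fun i => {B i} : ι → Finset ℕ) :
    Star U (Finset ℕ)) with hCB
  set D : Set (StarUnit U) := cellUnion n ((fun i => Finset.Icc (A i) (B i) : ι → Finset ℕ) :
    Star U (Finset ℕ)) with hD
  set L : Set (StarUnit U) := cellUnion n ((fun i => Finset.Iic (A i) : ι → Finset ℕ) :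
    Star U (Finset ℕ)) with hL
  set R : Set (StarUnit U) := cellUnion n ((fun i => Finset.Ico (B i) (n i) : ι → Finset ℕ) :
    Star U (Finset ℕ)) with hR
  have hCA0 : μ CA = 0 := by
    refine le_antisymm ((h.loebOuter_cellUnion_le_length hk (le_refl α) ?_ ?_).trans
      (by simp)) bot_le
    · filter_upwards [hAn] with i hi m hm
      rw [Finset.mem_singleton.1 hm]
      exact Finset.mem_range.2 hi
    · intro ε hε
      filter_upwards [hAge ε hε, hAle ε hε] with i h1 h2 m hm
      have hm := Finset.mem_singleton.1 hm
      exact ⟨h1 m hm.ge, h2 m hm.le⟩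
  have hCB0 : μ CB = 0 := by
    refine le_antisymm ((h.loebOuter_cellUnion_le_length hk (le_refl β) ?_ ?_).trans
      (by simp)) bot_le
    · filter_upwards [hBn] with i hi m hm
      rw [Finset.mem_singleton.1 hm]
      exact Finset.mem_range.2 hi
    · intro ε hε
      filter_upwards [hBge ε hε, hBle ε hε] with i h1 h2 m hm
      have hm := Finset.mem_singleton.1 hm
      exact ⟨h1 m hm.ge, h2 m hm.le⟩
  have hDle : μ D ≤ ENNReal.ofReal (β - α) := by
    refine h.loebOuter_cellUnion_le_length hk hαβ ?_ ?_
    · filter_upwards [hBn] with i hi m hm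
      exact Finset.mem_range.2 ((Finset.mem_Icc.1 hm).2.trans_lt hi)
    · intro ε hε
      filter_upwards [hAge ε hε, hBle ε hε] with i h1 h2 m hm
      exact ⟨h1 m (Finset.mem_Icc.1 hm).1, h2 m (Finset.mem_Icc.1 hm).2⟩
  have hLle : μ L ≤ ENNReal.ofReal (α - 0) := by
    refine h.loebOuter_cellUnion_le_length hk hα.1 ?_ ?_
    · filter_upwards [hAn] with i hi m hm
      exact Finset.mem_range.2 ((Finset.mem_Iic.1 hm).trans_lt hi)
    · intro ε hε
      filter_upwards [hAle ε hε] with i h2 m hm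
      refine ⟨?_, h2 m (Finset.mem_Iic.1 hm)⟩
      have : (0 : ℝ) ≤ (m : ℝ) / n i := by positivity
      linarith
  have hRle : μ R ≤ ENNReal.ofReal (1 - β) := by
    refine h.loebOuter_cellUnion_le_length hk hβ.2 ?_ ?_
    · exact Eventually.of_forall fun i m hm => Finset.mem_range.2 (Finset.mem_Ico.1 hm).2
    · intro ε hε
      filter_upwards [hBge ε hε] with i h1 m hm
      refine ⟨h1 m (Finset.mem_Ico.1 hm).1, ?_⟩
      have h3 : (m : ℝ) ≤ n i := by exact_mod_cast (Finset.mem_Ico.1 hm).2.le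
      have : (m : ℝ) / n i ≤ 1 := div_le_one_of_le₀ h3 (Nat.cast_nonneg _)
      linarith
  have hVsub : V ⊆ Set.Ioo a b := by
    intro x hx
    obtain ⟨f, hf, hf'⟩ := x.exists_rep
    rw [hV, mem_cellUnion_coe h.pos hf] at hx
    rw [hIoo hf]
    filter_upwards [hx] with i hi
    obtain ⟨h1, h2⟩ := Finset.mem_Ioo.1 hi
    have hmono : Monotone fun t : ℝ => ⌊(n i : ℝ) * t⌋₊ := fun s t hst =>
      Nat.floor_le_floor (mul_le_mul_of_nonneg_left hst (Nat.cast_nonneg _))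
    exact ⟨hmono.reflect_lt h1, hmono.reflect_lt h2⟩
  have hsubD : Set.Ioo a b ⊆ D := by
    intro x hx
    obtain ⟨f, hf, hf'⟩ := x.exists_rep
    rw [hIoo hf] at hx
    rw [hD, mem_cellUnion_coe h.pos hf]
    filter_upwards [hx] with i hi
    exact Finset.mem_Icc.2
      ⟨Nat.floor_le_floor (mul_le_mul_of_nonneg_left hi.1.le (Nat.cast_nonneg _)),
        Nat.floor_le_floor (mul_le_mul_of_nonneg_left hi.2.le (Nat.cast_nonneg _))⟩
  have hDsub : D ⊆ V ∪ (CA ∪ CB) := by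
    intro x hx
    obtain ⟨f, hf, hf'⟩ := x.exists_rep
    rw [hD, mem_cellUnion_coe h.pos hf] at hx
    rw [Set.mem_union, Set.mem_union, hV, hCA, hCB, mem_cellUnion_coe h.pos hf,
      mem_cellUnion_coe h.pos hf, mem_cellUnion_coe h.pos hf, ← Ultrafilter.eventually_or,
      ← Ultrafilter.eventually_or]
    filter_upwards [hx] with i hi
    simp only [Finset.mem_Icc, Finset.mem_Ioo, Finset.mem_singleton] at hi ⊢
    omega
  have huniv : Set.univ ⊆ Set.Ioo a b ∪ (L ∪ R) := by
    intro x _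
    obtain ⟨f, hf, hf'⟩ := x.exists_rep
    rw [Set.mem_union, Set.mem_union, hIoo hf, hL, hR, mem_cellUnion_coe h.pos hf,
      mem_cellUnion_coe h.pos hf, ← Ultrafilter.eventually_or, ← Ultrafilter.eventually_or]
    filter_upwards [hf', h.pos] with i h1 h2
    have hmono : Monotone fun t : ℝ => ⌊(n i : ℝ) * t⌋₊ := fun s t hst =>
      Nat.floor_le_floor (mul_le_mul_of_nonneg_left hst (Nat.cast_nonneg _))
    rw [Finset.mem_Iic, Finset.mem_Ico]
    rcases le_or_gt (f i) (fa i) with h3 | h3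
    · exact Or.inr (Or.inl (hmono h3))
    · rcases le_or_gt (fb i) (f i) with h4 | h4
      · exact Or.inr (Or.inr ⟨hmono h4, floor_mul_lt h2 h1⟩)
      · exact Or.inl ⟨h3, h4⟩
  have hmeas : MeasurableSet[loebAlgebra (n : Star U ℕ) (g : Star U (ℕ → ℝ))] (Set.Ioo a b) := by
    have h1 : Set.Ioo a b = V ∪ (Set.Ioo a b \ V) := (Set.union_sdiff_cancel hVsub).symm
    rw [h1]
    refine @MeasurableSet.union _ (loebAlgebra (n : Star U ℕ) (g : Star U (ℕ → ℝ))) _ _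
      (h.measurableSet_cellUnion _) (measurableSet_loebAlgebra_of_null ?_)
    refine le_antisymm ((measure_mono (t := CA ∪ CB) ?_).trans ((measure_union_le CA CB).trans ?_)) bot_le
    · rintro x ⟨hx, hxV⟩
      exact (hDsub (hsubD hx)).resolve_left hxV
    · rw [hCA0, hCB0, add_zero]
  refine ⟨hmeas, ?_⟩
  rw [loebMeasure_apply hmeas, hst]
  refine le_antisymm ((μ.mono hsubD).trans hDle) ?_
  -- The lower bound comes from upper bounds on the complement: `L` and `R` have total outer measure
  -- at most `α + (1 - β)`.
  have h1 : 1 ≤ μ (Set.Ioo a b) + ENNReal.ofReal (1 - (β - α)) := by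
    refine h.one_le_loebOuter_univ.trans ((measure_mono huniv).trans ((measure_union_le _ _).trans ?_))
    refine add_le_add le_rfl ((measure_union_le _ _).trans ((add_le_add hLle hRle).trans ?_))
    rw [← ENNReal.ofReal_add (by linarith [hα.1]) (by linarith [hβ.2])]
    exact ENNReal.ofReal_le_ofReal (by linarith)
  have h2 : ENNReal.ofReal (β - α) + ENNReal.ofReal (1 - (β - α)) = 1 := by
    rw [← ENNReal.ofReal_add (by linarith) (by linarith [hα.1, hβ.2])]
    simp
  rw [← h2] at h1
  exact (ENNReal.add_le_add_iff_right ENNReal.ofReal_ne_top).1 h1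

/-- Only the inequality between outer measure and premeasure enters: a union of cells containing an
interval has at least the mass of the interval. -/
theorem IsSample.tendsto_of_weaklyEquidistributed (h : IsSample U n g)
    (hW : WeaklyEquidistributed (n : Star U ℕ) (g : Star U (ℕ → ℝ))) {k : ℤ} (hk : k ≠ 0) :
    Tendsto (fun i => cellMean (n i) (g i) k) U (𝓝 0) := by
  refine tendsto_sum_mul_exp_of_le (S := fun i => Finset.range (n i))
    (w := fun i => stdCellMass (n i) (g i)) (y := fun i m => (m : ℝ) / n i)
    (Eventually.of_forall fun i m _ => stdCellMass_nonneg _ _ _) h.sum_eq_one ?_ ?_ hk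
  · filter_upwards [h.pos] with i hi m hm
    have hi' : (0 : ℝ) < n i := by exact_mod_cast hi
    refine ⟨by positivity, (div_lt_one hi').2 ?_⟩
    exact_mod_cast Finset.mem_range.1 hm
  · intro a b ha hab hb ε hε
    -- shrink the interval on the left, so that the cells of its points have endpoints in `[a, b)`
    rcases le_or_gt (b - a) ε with hε' | hε'
    · refine Eventually.of_forall fun i => le_trans (by linarith)
        (Finset.sum_nonneg fun m _ => stdCellMass_nonneg _ _ _)
    set J : ι → Finset ℕ := fun i =>
      (Finset.range (n i)).filter fun m => a ≤ (m : ℝ) / n i ∧ (m : ℝ) / n i < b with hJdef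
    have hJ : ∀ᶠ i in (U : Filter ι), J i ⊆ Finset.range (n i) :=
      Eventually.of_forall fun i => Finset.filter_subset _ _
    let a' : StarUnit U := ⟨((fun _ => a + ε / 2 : ι → ℝ) : Star U ℝ),
      Germ.coe_le.2 (Eventually.of_forall fun _ => by linarith),
      Germ.coe_lt.2 (Eventually.of_forall fun _ => by linarith)⟩
    let b' : StarUnit U := ⟨((fun _ => b : ι → ℝ) : Star U ℝ),
      Germ.coe_le.2 (Eventually.of_forall fun _ => by linarith),
      Germ.coe_lt.2 (Eventually.of_forall fun _ => hb)⟩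
    have hab' : a' ≤ b' := Germ.coe_le.2 (Eventually.of_forall fun _ => by linarith)
    obtain ⟨h1, h2⟩ := hW a' b' hab'
    have hsub : Set.Ioo a' b' ⊆ cellUnion (n : Star U ℕ) (J : Star U (Finset ℕ)) := by
      intro x hx
      obtain ⟨f, hf, hf'⟩ := x.exists_rep
      have hx' : (a' : Star U ℝ) < x ∧ (x : Star U ℝ) < b' := hx
      rw [hf] at hx'
      rw [mem_cellUnion_coe h.pos hf]
      have hlim := (tendsto_one_div_atTop_nhds_zero_nat (𝕜 := ℝ)).comp h.tendsto
      filter_upwards [h.pos, hf', Germ.coe_lt.1 hx'.1, Germ.coe_lt.1 hx'.2,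
        (tendsto_order.1 hlim).2 (ε / 2) (by positivity)] with i h3 h4 h5 h6 h7
      have hi' : (0 : ℝ) < n i := by exact_mod_cast h3
      have h7 : 1 / (n i : ℝ) < ε / 2 := h7
      obtain ⟨h8, h9⟩ := (floor_mul_eq_iff h3 h4.1).1 rfl
      rw [add_div] at h9
      exact Finset.mem_filter.2 ⟨Finset.mem_range.2 (floor_mul_lt h3 h4), by linarith, by linarith⟩
    rw [loebMeasure_apply h1] at h2
    have hst : ArchimedeanClass.stdPart ((b' : Star U ℝ) - (a' : Star U ℝ)) = b - (a + ε / 2) :=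
      stdPart_coe_of_tendsto tendsto_const_nhds
    have h3 := h2.ge.trans (((loebOuter _ _).mono hsub).trans
      (loebOuter_cellUnion_le _ (isIndexSet_coe.2 hJ)))
    rw [hst] at h3
    have h4 : b - (a + ε / 2) ≤ ArchimedeanClass.stdPart (delta (n : Star U ℕ)
        (g : Star U (ℕ → ℝ)) (J : Star U (Finset ℕ))) := by
      by_contra! hlt
      exact absurd ((ENNReal.ofReal_lt_ofReal_iff (by linarith)).2 hlt) (not_lt.2 h3)
    filter_upwards [(tendsto_order.1 (h.tendsto_delta hJ)).1 (b - a - ε) (by linarith)] with i hi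
    exact hi.le

end Equidistribution

/-! ### Weyl means and internal data in terms of representatives -/

section WeylMean

variable {ι : Type u} {U : Ultrafilter ι} {n : ι → ℕ} {g : ι → ℕ → ℝ}

theorem isInfinitesimal_coe {z : ι → ℂ} :
    Star.IsInfinitesimal (z : Star U ℂ) ↔ Tendsto z U (𝓝 0) := by
  simp only [Metric.tendsto_nhds, dist_zero_right]
  exact forall₂_congr fun ε _ => Germ.coe_lt

theorem IsSample.weylMean_const (h : IsSample U n g) (k : ℤ) :
    weylMean (n : Star U ℕ) (g : Star U (ℕ → ℝ)) (Germ.const k : Star U ℤ)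
      = ((fun i => cellMean (n i) (g i) k : ι → ℂ) : Star U ℂ) := by
  have h1 : weylMean (n : Star U ℕ) (g : Star U (ℕ → ℝ)) (Germ.const k : Star U ℤ)
      = ((fun i => 1 / (n i : ℂ) * ∑ j ∈ Finset.Icc 1 (n i), Complex.exp (2 * Real.pi * Complex.I *
          k * (((⌊(n i : ℝ) * g i j⌋ : ℝ) / n i : ℝ) : ℂ)) : ι → ℂ) : Star U ℂ) := rfl
  rw [h1]
  refine Germ.coe_eq.2 ?_
  filter_upwards [h.pos, h.mem] with i h2 h3
  rw [cellMean, sum_stdCellMass_mul h2 h3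
    fun m => Complex.exp (2 * Real.pi * Complex.I * k * ((m : ℝ) / n i : ℝ))]
  congr 1
  refine Finset.sum_congr rfl fun j hj => ?_
  rw [natCast_floor_eq_intCast_floor (mul_nonneg (Nat.cast_nonneg _) (h3 j hj).1)]

/-- A representative takes finitely many values `U`-almost everywhere, and the ultrafilter selects
one of them. -/
theorem Star.IsFinite.exists_eq_const {k : Star U ℤ} (hk : k.IsFinite) :
    ∃ m : ℤ, k = Germ.const m := by
  obtain ⟨N, h1, h2⟩ := hk
  induction k using Germ.inductionOn with
  | _ f =>
    have h3 : ∀ᶠ i in (U : Filter ι), -(N : ℤ) ≤ f i := Germ.coe_le.1 h1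
    have h4 : ∀ᶠ i in (U : Filter ι), f i ≤ (N : ℤ) := Germ.coe_le.1 h2
    obtain ⟨m, -, hm⟩ := (Ultrafilter.eventually_exists_mem_iff (f := U)
      (P := fun m i => f i = m) (Set.finite_Icc (-(N : ℤ)) N)).1
        ((h3.and h4).mono fun i hi => ⟨f i, hi, rfl⟩)
    exact ⟨m, Germ.coe_eq.2 hm⟩

theorem tendsto_atTop_of_isInfinite (hn : Star.IsInfinite (n : Star U ℕ)) :
    Tendsto n U atTop :=
  tendsto_atTop.2 fun N => (Germ.coe_lt.1 (hn N)).mono fun _ => le_of_lt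

theorem isSample_of_app_mem (hn : Star.IsInfinite (n : Star U ℕ))
    (hs : ∀ i : Star U ℕ, 1 ≤ i → i ≤ (n : Star U ℕ) →
      Star.app (g : Star U (ℕ → ℝ)) i ∈ Set.Ico (0 : Star U ℝ) 1) : IsSample U n g := by
  refine ⟨tendsto_atTop_of_isInfinite hn, ?_⟩
  by_contra hcon
  rw [← Ultrafilter.eventually_not] at hcon
  -- Choosing one bad index for each `i`, with dummy value `0` if there is none, produces an
  -- internal index that violates `hs`.
  have hex : ∀ i, ∃ j, (¬ ∀ j ∈ Finset.Icc 1 (n i), g i j ∈ Set.Ico 0 1) →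
      j ∈ Finset.Icc 1 (n i) ∧ g i j ∉ Set.Ico 0 1 := by
    intro i
    by_cases hi : ∀ j ∈ Finset.Icc 1 (n i), g i j ∈ Set.Ico 0 1
    · exact ⟨0, fun h => absurd hi h⟩
    · push Not at hi
      obtain ⟨j, hj⟩ := hi
      exact ⟨j, fun _ => hj⟩
  choose j hj using hex
  obtain ⟨h1, h2⟩ := hs (j : Star U ℕ)
    (Germ.coe_le.2 (hcon.mono fun i hi => (Finset.mem_Icc.1 (hj i hi).1).1))
    (Germ.coe_le.2 (hcon.mono fun i hi => (Finset.mem_Icc.1 (hj i hi).1).2))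
  have h1' : ∀ᶠ i in (U : Filter ι), 0 ≤ g i (j i) := Germ.coe_le.1 h1
  have h2' : ∀ᶠ i in (U : Filter ι), g i (j i) < 1 := Germ.coe_lt.1 h2
  obtain ⟨i, h3, h4, h5⟩ := (h1'.and (h2'.and hcon)).exists
  exact (hj i h5).2 ⟨h3, h4⟩

end WeylMean

end NSWeyl

end

theorem mainTheorem3 {ι : Type*} (U : Ultrafilter ι)
    (η : NSWeyl.Star U ℕ) (hη : η.IsInfinite)
    (s : NSWeyl.Star U (ℕ → ℝ))
    (hs : ∀ i : NSWeyl.Star U ℕ, 1 ≤ i → i ≤ η → s.app i ∈ Set.Ico (0 : NSWeyl.Star U ℝ) 1) :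
    NSWeyl.WeaklyEquidistributed η s ↔
      ∀ k : NSWeyl.Star U ℤ, k.IsFinite → k ≠ 0 → -η.toInt ≤ k → k ≤ η.toInt - 1 →
        (NSWeyl.weylMean η s k).IsInfinitesimal := by
  induction η using Germ.inductionOn with
  | _ n =>
    induction s using Germ.inductionOn with
    | _ g =>
      have h := NSWeyl.isSample_of_app_mem hη hs
      constructor
      · rintro hW k hk hk0 - -
        obtain ⟨m, rfl⟩ := hk.exists_eq_const
        rw [h.weylMean_const, NSWeyl.isInfinitesimal_coe]
        exact h.tendsto_of_weaklyEquidistributed hW fun hm => hk0 (by rw [hm]; rfl)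
      · intro hk
        refine h.weaklyEquidistributed_of_tendsto fun m hm => ?_
        rw [← NSWeyl.isInfinitesimal_coe, ← h.weylMean_const]
        -- An infinite `η` exceeds `|m|`, which puts every standard `m` in the range from `-η` to `η
        -- - 1`.
        have hlarge := h.tendsto.eventually_ge_atTop (m.natAbs + 1)
        refine hk (Germ.const m) ⟨m.natAbs, ?_, ?_⟩ ?_ ?_ ?_
        · exact Germ.coe_le.2 (Eventually.of_forall fun _ => by dsimp; omega)
        · exact Germ.coe_le.2 (Eventually.of_forall fun _ => by dsimp; omega)
        · intro h0
          obtain ⟨i, hi⟩ := (Germ.coe_eq.1 h0).exists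
          exact hm hi
        · refine Germ.coe_le.2 (hlarge.mono fun i hi => ?_)
          dsimp
          omega
        · refine Germ.coe_le.2 (hlarge.mono fun i hi => ?_)
          dsimp
          omega
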